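/- For $1\le k\le n$, let $\mathrm{Lah}(n,k)$ denote a random variable with the Lah distribution $$\mathbb P[\mathrm{Lah}(n,k)=j]=\frac{1}{L(n,k)}\left[{n\atop j}\right]\left\{{j\atop k}\right\},\qquad j\in\{k,k+1,\ldots,n\},$$ where $\left[{n\atop j}\right]$ and $\left\{{j\atop k}\right\}$ are the (unsigned) Stirling numbers of the first and of the second kind, and $L(n,k)=\frac{n!}{k!}\binom{n-1}{k-1}$ is the Lah number. **Theorem (Central limit theorem, fixed $k$).** Let $k\in\{1,2,\ldots\}$ be fixed. Then, as $n\to\infty$, $$\frac{\mathrm{Lah}(n,k)-k\log n}{\sqrt{k\log n}}$$ converges in distribution to the standard normal distribution $N(0,1)$. -/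

import Mathlib

open MeasureTheory ProbabilityTheory Filter
open scoped Nat ENNReal

/-- The Lah number `L(n,k) = (n! / k!) * binom (n-1) (k-1)`, for `1 ≤ k ≤ n` (the division is
exact there). -/
def lahNumber (n k : ℕ) : ℕ := n ! / k ! * (n - 1).choose (k - 1)

theorem sum_stirling_succ_succ (n k : ℕ) :
    ∑ j ∈ Finset.range (n + 2), Nat.stirlingFirst (n + 1) j * Nat.stirlingSecond j (k + 1) =
      (n + k + 1) *
        ∑ j ∈ Finset.range (n + 1), Nat.stirlingFirst n j * Nat.stirlingSecond j (k + 1) +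
      ∑ j ∈ Finset.range (n + 1), Nat.stirlingFirst n j * Nat.stirlingSecond j k := by
  have h0 : ∑ j ∈ Finset.range (n + 1),
      Nat.stirlingFirst n (j + 1) * Nat.stirlingSecond (j + 1) (k + 1) =
      ∑ j ∈ Finset.range (n + 1), Nat.stirlingFirst n j * Nat.stirlingSecond j (k + 1) := by
    rw [Finset.sum_range_succ, Nat.stirlingFirst_eq_zero_of_lt (Nat.lt_succ_self n),
      Finset.sum_range_succ' _ n]
    simp
  rw [Finset.sum_range_succ']
  simp only [Nat.stirlingFirst_succ_succ, add_mul, Finset.sum_add_distrib, mul_assoc,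
    Nat.stirlingSecond_zero_succ, mul_zero, add_zero, ← Finset.mul_sum]
  rw [h0]
  simp only [Nat.stirlingSecond_succ_succ, mul_add, Finset.sum_add_distrib]
  have h1 : ∑ j ∈ Finset.range (n + 1),
      Nat.stirlingFirst n j * ((k + 1) * Nat.stirlingSecond j (k + 1)) =
      (k + 1) *
        ∑ j ∈ Finset.range (n + 1), Nat.stirlingFirst n j * Nat.stirlingSecond j (k + 1) := by
    rw [Finset.mul_sum]
    exact Finset.sum_congr rfl fun j _ => by ring
  rw [h1]
  ring

theorem factorial_mul_sum_stirling (n k : ℕ) :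
    (k + 1)! * ∑ j ∈ Finset.range (n + 2),
      Nat.stirlingFirst (n + 1) j * Nat.stirlingSecond j (k + 1) = (n + 1)! * n.choose k := by
  induction n generalizing k with
  | zero =>
    cases k with
    | zero => decide
    | succ k => simp [Finset.sum_range_succ, Nat.stirlingSecond]
  | succ n ih =>
    rw [sum_stirling_succ_succ, mul_add, mul_left_comm, ih]
    cases k with
    | zero =>
      have h : ∑ j ∈ Finset.range (n + 1 + 1),
          Nat.stirlingFirst (n + 1) j * Nat.stirlingSecond j 0 = 0 := by
        refine Finset.sum_eq_zero fun j _ => ?_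
        cases j <;> simp
      rw [h]
      simp [Nat.factorial_succ]
    | succ k =>
      rw [Nat.factorial_succ (k + 1), mul_assoc, ih, Nat.choose_succ_succ, Nat.factorial_succ (n + 1)]
      have h := Nat.choose_succ_right_eq n k
      rcases le_total k n with hkn | hkn
      · obtain ⟨m, rfl⟩ := Nat.exists_eq_add_of_le hkn
        rw [Nat.add_sub_cancel_left] at h
        simp only [Nat.succ_eq_add_one]
        linear_combination (k + m + 1)! * h
      · rcases hkn.eq_or_lt with rfl | hlt
        · simp only [Nat.choose_self, Nat.succ_eq_add_one, Nat.choose_succ_self]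
          ring
        · simp [Nat.choose_eq_zero_of_lt hlt, Nat.choose_eq_zero_of_lt (Nat.lt_succ_of_lt hlt)]

/-- The identity `∑_{j=k}^n [n,j] {j,k} = L(n,k)`. -/
theorem sum_stirling_eq_lahNumber {n k : ℕ} (hk : 1 ≤ k) (hkn : k ≤ n) :
    ∑ j ∈ Finset.Icc k n, Nat.stirlingFirst n j * Nat.stirlingSecond j k = lahNumber n k := by
  obtain ⟨m, rfl⟩ := Nat.exists_eq_add_of_le' (hk.trans hkn)
  obtain ⟨l, rfl⟩ := Nat.exists_eq_add_of_le' hk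
  have h1 : ∑ j ∈ Finset.Icc (l + 1) (m + 1),
      Nat.stirlingFirst (m + 1) j * Nat.stirlingSecond j (l + 1) =
      ∑ j ∈ Finset.range (m + 2), Nat.stirlingFirst (m + 1) j * Nat.stirlingSecond j (l + 1) := by
    refine Finset.sum_subset (fun j hj => ?_) fun j hj hj' => ?_
    · simp only [Finset.mem_Icc, Finset.mem_range] at *; omega
    · have : j < l + 1 := by simp only [Finset.mem_Icc, Finset.mem_range] at *; omega
      rw [Nat.stirlingSecond_eq_zero_of_lt this, mul_zero]
  refine Nat.eq_of_mul_eq_mul_left (Nat.factorial_pos (l + 1)) ?_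
  rw [h1, factorial_mul_sum_stirling, lahNumber, ← mul_assoc,
    Nat.mul_div_cancel' (Nat.factorial_dvd_factorial hkn)]
  simp

theorem lahNumber_pos {n k : ℕ} (hkn : k ≤ n) : 0 < lahNumber n k :=
  Nat.mul_pos (Nat.div_pos (Nat.factorial_le hkn) (Nat.factorial_pos k))
    (Nat.choose_pos (Nat.sub_le_sub_right hkn 1))

/-- The Lah distribution with parameters `1 ≤ k ≤ n`: the mass at `j ∈ {k, …, n}` is
`[n,j] {j,k} / L(n,k)`, with the unsigned Stirling numbers of the first and of the second kind
(the formula vanishes for all other `j`). -/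
noncomputable def lahPMF (n k : ℕ) (hk : 1 ≤ k) (hkn : k ≤ n) : PMF ℕ :=
  PMF.ofFinset
    (fun j => ((Nat.stirlingFirst n j * Nat.stirlingSecond j k : ℕ) : ℝ≥0∞) / (lahNumber n k : ℝ≥0∞))
    (Finset.Icc k n)
    (by
      simp only [div_eq_mul_inv]
      rw [← Finset.sum_mul, ← Nat.cast_sum, sum_stirling_eq_lahNumber hk hkn]
      exact ENNReal.mul_inv_cancel (Nat.cast_ne_zero.2 (lahNumber_pos hkn).ne')
        (ENNReal.natCast_ne_top _))
    (by
      intro j hj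
      rw [Finset.mem_Icc, not_and_or, not_le, not_le] at hj
      rcases hj with hj | hj
      · simp [Nat.stirlingSecond_eq_zero_of_lt hj]
      · simp [Nat.stirlingFirst_eq_zero_of_lt hj])

/-! Write G_l(t) for `lahGen n l t`, so that E t^Lah(n,k) = G_k(t) / G_k(1). Expanding (kt)^j in
falling factorials of k inside ∑_j [n,j] (kt)^j = ∏_{m<n} (kt + m) gives ∑_{l≤k} k(k-1)⋯(k-l+1)
G_l(t) = ∏_{m<n} (kt + m) (`sum_lahGen_mul_descFactorial`). On the closed unit disc the terms with l
< k are negligible against G_k(1), because L(n,l) / L(n,l+1) = l(l+1)/(n-l) → 0 for l ≥ 1. Hence E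
t^Lah(n,k) is ∏ (kt + m) / ∏ (k + m) up to o(1) (`tendsto_lahGen_div_sub`, `tendsto_prod_div`).

For t = exp(iθ/√(k log n)) and δ = k(t - 1) → 0, this quotient is ∏ (1 + δ/(k+m)) = exp(δ log n +
o(1)) (`tendsto_sum_log_one_add_div_sub`): asymptotically the Poisson law of mean k log n. The
Poisson central limit computation and Lévy's continuity theorem conclude. -/

/-- The generating polynomial `∑ j, [n,j] {j,k} t ^ j`, unnormalised, of the Lah distribution. -/
noncomputable def lahGen (n k : ℕ) (t : ℂ) : ℂ :=
  ∑ j ∈ Finset.range (n + 1),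
    ((Nat.stirlingFirst n j * Nat.stirlingSecond j k : ℕ) : ℂ) * t ^ j

/-! ### Stirling identities and the linear relation between the generating polynomials. -/

theorem sum_stirlingFirst_mul_pow {R : Type*} [CommSemiring R] (n : ℕ) (x : R) :
    ∑ j ∈ Finset.range (n + 1), (Nat.stirlingFirst n j : R) * x ^ j =
      ∏ m ∈ Finset.range n, (x + m) := by
  induction n with
  | zero => simp
  | succ n ih =>
    -- The index shift loses only the j = 0 term, where [n,0] * n = 0 for every n.
    have h : ∑ j ∈ Finset.range (n + 1), (Nat.stirlingFirst n (j + 1) : R) * x ^ (j + 1) * n =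
        (∑ j ∈ Finset.range (n + 1), (Nat.stirlingFirst n j : R) * x ^ j) * n := by
      rw [Finset.sum_mul, Finset.sum_range_succ, Finset.sum_range_succ',
        Nat.stirlingFirst_eq_zero_of_lt (Nat.lt_succ_self n)]
      cases n <;> simp
    rw [Finset.prod_range_succ, ← ih, Finset.sum_range_succ', mul_add, ← h, Finset.sum_mul]
    simp only [Nat.stirlingFirst_succ_zero, Nat.cast_zero, zero_mul, add_zero,
      ← Finset.sum_add_distrib]
    refine Finset.sum_congr rfl fun j _ => ?_
    rw [Nat.stirlingFirst_succ_succ]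
    push_cast
    ring

/-- Counts maps from a j-set to an x-set by the size l of the image. The induction uses that x times
the l-th falling factorial is l times it plus the next one. -/
theorem sum_stirlingSecond_mul_descFactorial (x j : ℕ) :
    ∑ l ∈ Finset.range (x + 1), Nat.stirlingSecond j l * x.descFactorial l = x ^ j := by
  induction j with
  | zero => rw [Finset.sum_range_succ']; simp
  | succ j ih =>
    rw [pow_succ, ← ih, Finset.sum_mul, Finset.sum_range_succ']
    have h : ∀ l ∈ Finset.range (x + 1),
        Nat.stirlingSecond j l * x.descFactorial l * x =
          Nat.stirlingSecond j l * l * x.descFactorial l +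
          Nat.stirlingSecond j l * x.descFactorial (l + 1) := by
      intro l hl
      obtain ⟨m, rfl⟩ := Nat.exists_eq_add_of_le (Nat.lt_succ_iff.1 (Finset.mem_range.1 hl))
      rw [Nat.descFactorial_succ, Nat.add_sub_cancel_left]
      ring
    rw [Finset.sum_congr rfl h, Finset.sum_add_distrib, Finset.sum_range_succ',
      Finset.sum_range_succ _ x, Nat.descFactorial_of_lt (Nat.lt_succ_self x)]
    simp only [Nat.stirlingSecond_succ_zero, zero_mul, mul_zero, add_zero,
      ← Finset.sum_add_distrib]
    refine Finset.sum_congr rfl fun l _ => ?_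
    rw [Nat.stirlingSecond_succ_succ]
    ring

/-- Since k is a natural number, its falling factorials vanish beyond l = k, so `lahGen n k t` is
the top term of a finite sum. -/
theorem sum_lahGen_mul_descFactorial (n k : ℕ) (t : ℂ) :
    ∑ l ∈ Finset.range (k + 1), lahGen n l t * k.descFactorial l =
      ∏ m ∈ Finset.range n, (k * t + m) := by
  simp only [← sum_stirlingFirst_mul_pow, lahGen, Finset.sum_mul]
  rw [Finset.sum_comm]
  refine Finset.sum_congr rfl fun j _ => ?_
  have h := congrArg (Nat.cast : ℕ → ℂ) (sum_stirlingSecond_mul_descFactorial k j)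
  push_cast at h
  rw [mul_pow, ← h, Finset.sum_mul, Finset.mul_sum]
  refine Finset.sum_congr rfl fun l _ => ?_
  push_cast
  ring

theorem lahGen_eq (n k : ℕ) (t : ℂ) :
    k ! * lahGen n k t = ∏ m ∈ Finset.range n, (k * t + m) -
      ∑ l ∈ Finset.range k, lahGen n l t * k.descFactorial l := by
  rw [← sum_lahGen_mul_descFactorial, Finset.sum_range_succ, Nat.descFactorial_self]
  ring

/-! ### Negligibility of the lower indices. -/

theorem norm_lahGen_le (n k : ℕ) {t : ℂ} (ht : ‖t‖ ≤ 1) :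
    ‖lahGen n k t‖ ≤ ‖lahGen n k 1‖ := by
  have h : lahGen n k 1 = ((∑ j ∈ Finset.range (n + 1),
      Nat.stirlingFirst n j * Nat.stirlingSecond j k : ℕ) : ℂ) := by
    simp [lahGen]
  rw [h, Complex.norm_natCast, lahGen, Nat.cast_sum]
  refine norm_sum_le_of_le _ fun j _ => ?_
  rw [norm_mul, Complex.norm_natCast, norm_pow]
  exact mul_le_of_le_one_right (Nat.cast_nonneg _) (pow_le_one₀ (norm_nonneg _) ht)

theorem lahGen_one {n k : ℕ} (hk : 1 ≤ k) (hkn : k ≤ n) : lahGen n k 1 = lahNumber n k := by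
  have h : lahGen n k 1 = ((∑ j ∈ Finset.range (n + 1),
      Nat.stirlingFirst n j * Nat.stirlingSecond j k : ℕ) : ℂ) := by
    simp [lahGen]
  rw [h, ← sum_stirling_eq_lahNumber hk hkn]
  congr 1
  refine (Finset.sum_subset (fun j hj => ?_) fun j _ hj' => ?_).symm
  · simp only [Finset.mem_Icc, Finset.mem_range] at *; omega
  · have : j < k := by simp only [Finset.mem_Icc, Finset.mem_range] at *; omega
    rw [Nat.stirlingSecond_eq_zero_of_lt this, mul_zero]

theorem factorial_mul_lahGen_one (n k : ℕ) :
    ((k + 1)! : ℂ) * lahGen (n + 1) (k + 1) 1 = (n + 1)! * n.choose k := by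
  have h := congrArg (Nat.cast : ℕ → ℂ) (factorial_mul_sum_stirling n k)
  push_cast at h
  simp [lahGen, ← h]

theorem lahGen_one_succ_mul (n k : ℕ) :
    ((k + 1) * (k + 2) : ℂ) * lahGen (n + k + 1) (k + 2) 1 = n * lahGen (n + k + 1) (k + 1) 1 := by
  have h1 := factorial_mul_lahGen_one (n + k) k
  have h2 := factorial_mul_lahGen_one (n + k) (k + 1)
  have h3 := congrArg (Nat.cast : ℕ → ℂ) (Nat.choose_succ_right_eq (n + k) k)
  rw [Nat.add_sub_cancel] at h3
  push_cast at h3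
  have h4 : ((k + 1)! : ℂ) ≠ 0 := by exact_mod_cast (Nat.factorial_pos _).ne'
  refine mul_left_cancel₀ h4 ?_
  rw [Nat.factorial_succ (k + 1)] at h2
  push_cast at h2
  linear_combination (k + 1 : ℂ) * h2 - n * h1 + (n + k + 1)! * h3

theorem lahGen_one_ne_zero {n k : ℕ} (hk : 1 ≤ k) (hkn : k ≤ n) : lahGen n k 1 ≠ 0 := by
  rw [lahGen_one hk hkn]
  exact_mod_cast (lahNumber_pos hkn).ne'

theorem tendsto_lahGen_one_div_succ (k : ℕ) :
    Tendsto (fun n : ℕ => lahGen n k 1 / lahGen n (k + 1) 1) atTop (nhds 0) := by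
  cases k with
  | zero =>
    refine tendsto_const_nhds.congr' ?_
    filter_upwards [eventually_ge_atTop 1] with n hn
    have : lahGen n 0 1 = 0 := by
      refine Finset.sum_eq_zero fun j _ => ?_
      obtain ⟨n, rfl⟩ := Nat.exists_eq_add_of_le' hn
      cases j <;> simp
    simp [this]
  | succ k =>
    rw [← tendsto_add_atTop_iff_nat (k + 1)]
    have h : Tendsto (fun n : ℕ => ((k + 1) * (k + 2) : ℂ) / n) atTop (nhds 0) :=
      tendsto_const_div_atTop_nhds_zero_nat _
    refine h.congr' ?_
    filter_upwards [eventually_ge_atTop 1] with n hn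
    have h1 := lahGen_one_succ_mul n k
    have h2 : lahGen (n + k + 1) (k + 2) 1 ≠ 0 := lahGen_one_ne_zero (by omega) (by omega)
    have h3 : (n : ℂ) ≠ 0 := by exact_mod_cast (by omega : n ≠ 0)
    rw [← add_assoc, div_eq_div_iff h3 h2, h1]
    ring

theorem tendsto_lahGen_one_div {l k : ℕ} (h : l < k) :
    Tendsto (fun n : ℕ => lahGen n l 1 / lahGen n k 1) atTop (nhds 0) := by
  induction k, h using Nat.le_induction with
  | base => exact tendsto_lahGen_one_div_succ l
  | succ k hk ih =>
    have := ih.mul (tendsto_lahGen_one_div_succ k)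
    rw [mul_zero] at this
    refine this.congr' ?_
    filter_upwards [eventually_ge_atTop k] with n hn
    exact div_mul_div_cancel₀ (lahGen_one_ne_zero (by omega) hn)

/-- The bound by the value at 1 is uniform on the unit disc, so t may vary with n. -/
theorem tendsto_sum_lahGen_div (k : ℕ) {t : ℕ → ℂ} (ht : ∀ n, ‖t n‖ ≤ 1) :
    Tendsto (fun n : ℕ => (∑ l ∈ Finset.range k, lahGen n l (t n) * k.descFactorial l) /
      (k ! * lahGen n k 1)) atTop (nhds 0) := by
  have h : ∀ l ∈ Finset.range k, Tendsto (fun n : ℕ =>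
      lahGen n l (t n) / lahGen n k 1 * (k.descFactorial l / k !)) atTop (nhds 0) := by
    intro l hl
    have h1 : Tendsto (fun n : ℕ => lahGen n l (t n) / lahGen n k 1) atTop (nhds 0) := by
      refine squeeze_zero_norm (fun n => ?_)
        (tendsto_zero_iff_norm_tendsto_zero.1 (tendsto_lahGen_one_div (Finset.mem_range.1 hl)))
      rw [norm_div, norm_div]
      gcongr
      exact norm_lahGen_le n l (ht n)
    simpa using h1.mul_const (k.descFactorial l / k ! : ℂ)
  have := tendsto_finsetSum _ h
  rw [Finset.sum_const_zero] at this
  refine this.congr fun n => ?_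
  rw [Finset.sum_div]
  exact Finset.sum_congr rfl fun l _ => by ring

/-- As `n → ∞`, the `k`-th rising factorial term dominates the generating polynomial. -/
theorem tendsto_lahGen_div_sub (k : ℕ) (hk : 1 ≤ k) {t : ℕ → ℂ} (ht : ∀ n, ‖t n‖ ≤ 1) :
    Tendsto (fun n : ℕ => lahGen n k (t n) / lahGen n k 1 -
      (∏ m ∈ Finset.range n, (k * t n + m)) / (k ! * lahGen n k 1)) atTop (nhds 0) := by
  have h := (tendsto_sum_lahGen_div k ht).neg
  rw [neg_zero] at h
  refine h.congr' ?_
  filter_upwards [eventually_ge_atTop k] with n hn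
  have h1 := lahGen_one_ne_zero hk hn
  have h2 : (k ! : ℂ) ≠ 0 := by exact_mod_cast (Nat.factorial_pos _).ne'
  have h3 := lahGen_eq n k (t n)
  field_simp
  linear_combination -h3

/-- The case t = 1 of the preceding estimate fixes the normalisation. -/
theorem tendsto_prod_div (k : ℕ) (hk : 1 ≤ k) :
    Tendsto (fun n : ℕ => (∏ m ∈ Finset.range n, ((k : ℂ) + m)) / (k ! * lahGen n k 1))
      atTop (nhds 1) := by
  have h := (tendsto_lahGen_div_sub k hk (t := fun _ => 1) (by simp)).const_sub 1
  rw [sub_zero] at h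
  refine h.congr' ?_
  filter_upwards [eventually_ge_atTop k] with n hn
  rw [div_self (lahGen_one_ne_zero hk hn), mul_one]
  ring

/-! ### Asymptotics of the product of the factors 1 + δ/(k+m). -/

theorem sum_inv_add_one_sq_le (n : ℕ) :
    ∑ m ∈ Finset.range n, (((m : ℝ) + 1) ^ 2)⁻¹ ≤ ∑' m : ℕ, (((m : ℝ) + 1) ^ 2)⁻¹ := by
  have h : Summable fun m : ℕ => (((m : ℝ) + 1) ^ 2)⁻¹ := by
    have := (summable_nat_add_iff 1).2 (Real.summable_nat_pow_inv.2 one_lt_two)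
    simpa using this
  exact h.sum_le_tsum _ fun m _ => by positivity

/-- Comparison with the harmonic numbers. Boundedness suffices, as the difference gets multiplied by
δ → 0. -/
theorem exists_abs_sum_inv_sub_log_le (k : ℕ) (hk : 1 ≤ k) :
    ∃ C : ℝ, 0 ≤ C ∧ ∀ n : ℕ,
      |∑ m ∈ Finset.range n, ((k : ℝ) + m)⁻¹ - Real.log n| ≤ C := by
  obtain ⟨C, hC⟩ :=
    (Metric.isBounded_range_of_tendsto _ Real.tendsto_harmonic_sub_log).exists_norm_le
  have hC' : ∀ n : ℕ, |(harmonic n : ℝ) - Real.log n| ≤ C := fun n => hC _ ⟨n, rfl⟩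
  have h : ∀ n : ℕ, |∑ m ∈ Finset.range n, ((k : ℝ) + m)⁻¹ - harmonic n| ≤
      k * ∑' m : ℕ, (((m : ℝ) + 1) ^ 2)⁻¹ := by
    intro n
    refine le_trans ?_ (mul_le_mul_of_nonneg_left (sum_inv_add_one_sq_le n) (Nat.cast_nonneg k))
    rw [harmonic, Rat.cast_sum, ← Finset.sum_sub_distrib, Finset.mul_sum]
    refine (Finset.abs_sum_le_sum_abs _ _).trans (Finset.sum_le_sum fun m _ => ?_)
    have hk' : (1 : ℝ) ≤ k := by exact_mod_cast hk
    have hm : (0 : ℝ) ≤ m := Nat.cast_nonneg m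
    have h1 : ((k : ℝ) + m)⁻¹ - ((m : ℝ) + 1)⁻¹ = -((k - 1) / ((k + m) * (m + 1))) := by
      field_simp
      ring
    push_cast
    rw [h1, abs_neg, abs_of_nonneg (div_nonneg (by linarith) (by positivity)), ← div_eq_mul_inv]
    refine div_le_div₀ (by positivity) (by linarith) (by positivity) ?_
    rw [sq]
    exact mul_le_mul_of_nonneg_right (by linarith) (by positivity)
  refine ⟨_, add_nonneg ((abs_nonneg _).trans (h 0)) ((abs_nonneg _).trans (hC' 0)), fun n => ?_⟩
  exact (abs_sub_le _ _ _).trans (add_le_add (h n) (hC' n))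

theorem norm_sum_log_one_add_div_sub_le (k n : ℕ) (hk : 1 ≤ k) {δ : ℂ} (hδ : ‖δ‖ ≤ 1 / 2) :
    ‖∑ m ∈ Finset.range n, Complex.log (1 + δ / (k + m)) -
        δ * ((∑ m ∈ Finset.range n, ((k : ℝ) + m)⁻¹ : ℝ) : ℂ)‖ ≤
      ‖δ‖ ^ 2 * ∑' m : ℕ, (((m : ℝ) + 1) ^ 2)⁻¹ := by
  refine le_trans ?_ (mul_le_mul_of_nonneg_left (sum_inv_add_one_sq_le n) (by positivity))
  rw [Complex.ofReal_sum, Finset.mul_sum, ← Finset.sum_sub_distrib, Finset.mul_sum]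
  refine norm_sum_le_of_le _ fun m _ => ?_
  have hk' : (1 : ℝ) ≤ k := by exact_mod_cast hk
  have h1 : ‖δ / (k + m : ℂ)‖ ≤ ‖δ‖ / (m + 1) := by
    have : ‖(k + m : ℂ)‖ = k + m := by exact_mod_cast Complex.norm_natCast (k + m)
    rw [norm_div, this]
    exact div_le_div_of_nonneg_left (norm_nonneg _) (by positivity) (by linarith)
  have h2 : ‖δ‖ / (m + 1) ≤ 1 / 2 :=
    (div_le_self (norm_nonneg _) (by linarith [Nat.cast_nonneg (α := ℝ) m])).trans hδ
  -- This factor 2 cancels the 1/2 in |log(1+z) - z| ≤ |z|² (1-|z|)⁻¹ / 2.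
  have h3 : (1 - ‖δ / (k + m : ℂ)‖)⁻¹ ≤ 2 := by
    rw [inv_le_comm₀ (by linarith) two_pos]
    linarith
  have h5 : 0 ≤ (1 - ‖δ / (k + m : ℂ)‖)⁻¹ := inv_nonneg.2 (by linarith)
  have h4 := Complex.norm_log_one_add_sub_self_le (z := δ / (k + m)) (by linarith)
  push_cast
  rw [← div_eq_mul_inv]
  calc _ ≤ _ := h4
    _ ≤ (‖δ‖ / (m + 1)) ^ 2 * 2 / 2 := by gcongr
    _ = _ := by field_simp

/-- As |δ| < 1 ≤ k + m, no factor vanishes; exponentiating the sum of logarithms avoids any branch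
question. -/
theorem prod_add_div_eq_exp (k n : ℕ) (hk : 1 ≤ k) {δ : ℂ} (hδ : ‖δ‖ ≤ 1 / 2) :
    ∏ m ∈ Finset.range n, ((k : ℂ) + δ + m) = (∏ m ∈ Finset.range n, ((k : ℂ) + m)) *
      Complex.exp (∑ m ∈ Finset.range n, Complex.log (1 + δ / (k + m))) := by
  rw [Complex.exp_sum, ← Finset.prod_mul_distrib]
  refine Finset.prod_congr rfl fun m _ => ?_
  have h0 : (k + m : ℂ) ≠ 0 := by exact_mod_cast (by omega : k + m ≠ 0)
  have h1 : k + δ + m ≠ 0 := by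
    intro h
    have : δ = -((k + m : ℕ) : ℂ) := by push_cast; linear_combination h
    rw [this, norm_neg, Complex.norm_natCast] at hδ
    have : (1 : ℝ) ≤ (k + m : ℕ) := by exact_mod_cast (by omega : 1 ≤ k + m)
    linarith
  have h2 : 1 + δ / (k + m) = (k + δ + m) / (k + m) := by
    field_simp
    ring
  rw [Complex.exp_log (h2 ▸ div_ne_zero h1 h0), h2, mul_div_cancel₀ _ h0]

theorem tendsto_sum_log_one_add_div_sub (k : ℕ) (hk : 1 ≤ k) {δ : ℕ → ℂ}
    (hδ : Tendsto δ atTop (nhds 0)) :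
    Tendsto (fun n : ℕ => ∑ m ∈ Finset.range n, Complex.log (1 + δ n / (k + m)) -
      δ n * Real.log n) atTop (nhds 0) := by
  obtain ⟨C, hC0, hC⟩ := exists_abs_sum_inv_sub_log_le k hk
  have hn : Tendsto (fun n => ‖δ n‖) atTop (nhds 0) := by simpa using hδ.norm
  have hlim : Tendsto (fun n => ‖δ n‖ ^ 2 * (∑' m : ℕ, (((m : ℝ) + 1) ^ 2)⁻¹) + ‖δ n‖ * C)
      atTop (nhds 0) := by
    simpa using ((hn.pow 2).mul_const _).add (hn.mul_const C)
  refine squeeze_zero_norm' ?_ hlim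
  filter_upwards [hn.eventually_le_const (by norm_num : (0 : ℝ) < 1 / 2)] with n hδn
  refine (norm_sub_le_norm_sub_add_norm_sub _
    (δ n * ((∑ m ∈ Finset.range n, ((k : ℝ) + m)⁻¹ : ℝ) : ℂ)) _).trans ?_
  refine add_le_add (norm_sum_log_one_add_div_sub_le k n hk hδn) ?_
  rw [← mul_sub, norm_mul, ← Complex.ofReal_sub, Complex.norm_real]
  exact mul_le_mul_of_nonneg_left (hC n) (norm_nonneg _)

/-! ### Characteristic functions and passage to the limit. -/

/-- For `a → ∞`, the centred logarithm of the characteristic function of a rescaled Poisson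
variable of mean `a` tends to that of the standard normal distribution. -/
theorem tendsto_mul_exp_sub_one_sub (θ : ℝ) {a : ℕ → ℝ} (ha : Tendsto a atTop atTop) :
    Tendsto (fun n => a n * (Complex.exp ((θ / √(a n) : ℝ) * Complex.I) - 1) -
      (θ * √(a n) : ℝ) * Complex.I) atTop (nhds (-(θ : ℂ) ^ 2 / 2)) := by
  have hs : Tendsto (fun n => √(a n)) atTop atTop := Real.tendsto_sqrt_atTop.comp ha
  have hlim : Tendsto (fun n => |θ| ^ 3 / √(a n)) atTop (nhds 0) := hs.const_div_atTop _
  have hθ : Tendsto (fun n => |θ| / √(a n)) atTop (nhds 0) := hs.const_div_atTop _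
  rw [tendsto_iff_norm_sub_tendsto_zero]
  refine squeeze_zero_norm' ?_ hlim
  filter_upwards [ha.eventually_gt_atTop 0, hθ.eventually_le_const one_pos] with n hn hn1
  have hpos : 0 < √(a n) := Real.sqrt_pos.2 hn
  set x : ℂ := (θ / √(a n) : ℝ) * Complex.I with hx
  have hxn : ‖x‖ = |θ| / √(a n) := by
    rw [hx, norm_mul, Complex.norm_I, mul_one, Complex.norm_real, Real.norm_eq_abs, abs_div,
      abs_of_pos hpos]
  clear_value x
  -- With |x| = |θ|/√a, the cubic remainder times a is at most |θ|³/√a. The linear term cancels the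
  -- centring and the quadratic one gives -θ²/2.
  have hb := Complex.exp_bound (x := x) (hxn ▸ hn1) (n := 3) (by norm_num)
  have hsq : ((√(a n) : ℝ) : ℂ) ^ 2 = a n := by
    rw [← Complex.ofReal_pow, Real.sq_sqrt hn.le]
  have hne : ((√(a n) : ℝ) : ℂ) ≠ 0 := by exact_mod_cast hpos.ne'
  have h1 : a n * (Complex.exp x - 1) - (θ * √(a n) : ℝ) * Complex.I - -(θ : ℂ) ^ 2 / 2 =
      a n * (Complex.exp x - ∑ m ∈ Finset.range 3, x ^ m / m !) := by
    have e1 : (a n : ℂ) * x = (θ * √(a n) : ℝ) * Complex.I := by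
      rw [hx, ← hsq]
      push_cast
      field_simp
    have e2 : (a n : ℂ) * x ^ 2 = -(θ : ℂ) ^ 2 := by
      rw [hx, ← hsq, mul_pow, Complex.I_sq]
      push_cast
      field_simp
    simp only [Finset.sum_range_succ, Finset.sum_range_zero, Nat.factorial]
    push_cast
    push_cast at e1
    linear_combination e1 + e2 / 2
  rw [norm_norm, h1, norm_mul, Complex.norm_real, Real.norm_of_nonneg hn.le]
  calc a n * _ ≤ a n * (‖x‖ ^ 3 * 1) := by
        gcongr
        refine hb.trans ?_
        gcongr
        norm_num [Nat.factorial]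
    _ = _ := by
        rw [hxn]
        nth_rewrite 1 [← Real.sq_sqrt hn.le]
        field_simp

theorem integral_lahPMF {n k : ℕ} (hk : 1 ≤ k) (hkn : k ≤ n) (t : ℂ) :
    ∫ j, t ^ j ∂(lahPMF n k hk hkn).toMeasure = lahGen n k t / lahGen n k 1 := by
  have hsupp : ∀ j ∉ Finset.range (n + 1), lahPMF n k hk hkn j = 0 := by
    intro j hj
    refine PMF.ofFinset_apply_of_notMem _ _ fun h => hj ?_
    simp only [Finset.mem_Icc, Finset.mem_range] at *
    omega
  have hae : ∀ᵐ j ∂(lahPMF n k hk hkn).toMeasure, j ∈ Finset.range (n + 1) := by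
    rw [ae_iff, PMF.toMeasure_apply_eq_zero_iff _ (MeasurableSet.of_discrete),
      Set.disjoint_left]
    exact fun j hj hj' => hj (hsupp j hj')
  have hint : Integrable (fun j : ℕ => t ^ j) (lahPMF n k hk hkn).toMeasure := by
    refine Integrable.of_bound (Measurable.of_discrete.aestronglyMeasurable)
      (∑ j ∈ Finset.range (n + 1), ‖t ^ j‖) ?_
    filter_upwards [hae] with j hj
    exact Finset.single_le_sum (f := fun j => ‖t ^ j‖) (fun _ _ => norm_nonneg _) hj
  rw [PMF.integral_eq_tsum _ _ hint, tsum_eq_sum (s := Finset.range (n + 1)), lahGen,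
    lahGen_one hk hkn, Finset.sum_div]
  · refine Finset.sum_congr rfl fun j _ => ?_
    rw [lahPMF, PMF.ofFinset_apply, ENNReal.toReal_div, ENNReal.toReal_natCast,
      ENNReal.toReal_natCast, Complex.real_smul]
    push_cast
    ring
  · intro j hj
    simp [hsupp j hj]

theorem charFun_map_lah {n k : ℕ} (hk : 1 ≤ k) (hkn : k ≤ n) {Ω : Type*} [MeasurableSpace Ω]
    {P : Measure Ω} {X : Ω → ℕ} (hX : HasLaw X (lahPMF n k hk hkn).toMeasure P) (c s θ : ℝ) :
    charFun (P.map fun ω => ((X ω : ℝ) - c) / s) θ =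
      Complex.exp (-(θ * (c / s) : ℝ) * Complex.I) *
        (lahGen n k (Complex.exp ((θ / s : ℝ) * Complex.I)) / lahGen n k 1) := by
  have hm : AEMeasurable (fun ω => ((X ω : ℝ) - c) / s) P :=
    (Measurable.of_discrete (f := fun j : ℕ => ((j : ℝ) - c) / s)).comp_aemeasurable hX.aemeasurable
  rw [charFun_apply_real, integral_map hm (by fun_prop), ← integral_lahPMF hk hkn,
    ← integral_const_mul, ← hX.integral_comp (Measurable.of_discrete.aestronglyMeasurable)]
  refine integral_congr_ae (ae_of_all _ fun ω => ?_)
  simp only [Function.comp_apply]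
  rw [← Complex.exp_nat_mul, ← Complex.exp_add]
  congr 1
  push_cast
  ring

theorem tendsto_charFun_lah (k : ℕ) (hk : 1 ≤ k) (θ : ℝ) :
    Tendsto (fun n : ℕ => Complex.exp
        (-(θ * ((k * Real.log n) / √(k * Real.log n)) : ℝ) * Complex.I) *
      (lahGen n k (Complex.exp ((θ / √(k * Real.log n) : ℝ) * Complex.I)) / lahGen n k 1))
      atTop (nhds (Complex.exp (-(θ : ℂ) ^ 2 / 2))) := by
  have hk' : (0 : ℝ) < k := by exact_mod_cast hk
  set a : ℕ → ℝ := fun n => k * Real.log n with ha_def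
  have ha : Tendsto a atTop atTop :=
    (Real.tendsto_log_atTop.comp tendsto_natCast_atTop_atTop).const_mul_atTop hk'
  set t : ℕ → ℂ := fun n => Complex.exp ((θ / √(a n) : ℝ) * Complex.I) with ht_def
  have ht1 : ∀ n, ‖t n‖ = 1 := fun n => Complex.norm_exp_ofReal_mul_I _
  have ht : Tendsto t atTop (nhds 1) := by
    have h1 : Tendsto (fun n => θ / √(a n)) atTop (nhds 0) :=
      (Real.tendsto_sqrt_atTop.comp ha).const_div_atTop θ
    have h2 : Continuous fun x : ℝ => Complex.exp (x * Complex.I) := by fun_prop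
    have h3 := (h2.tendsto 0).comp h1
    simp only [Complex.ofReal_zero, zero_mul, Complex.exp_zero] at h3
    exact h3
  set δ : ℕ → ℂ := fun n => k * (t n - 1) with hδ_def
  have hδ : Tendsto δ atTop (nhds 0) := by
    simpa using (ht.sub_const 1).const_mul (k : ℂ)
  -- In the sum of the two exponents, a (t - 1) cancels δ log n.
  have hexp := (Complex.continuous_exp.tendsto _).comp
    ((tendsto_mul_exp_sub_one_sub θ ha).add (tendsto_sum_log_one_add_div_sub k hk hδ))
  rw [add_zero] at hexp
  have hmain := hexp.mul (tendsto_prod_div k hk)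
  rw [mul_one] at hmain
  -- The centring phase has modulus one, so it leaves the o(1) error unchanged in norm.
  have hrem : Tendsto (fun n : ℕ => Complex.exp (-(θ * (a n / √(a n)) : ℝ) * Complex.I) *
      (lahGen n k (t n) / lahGen n k 1 -
        (∏ m ∈ Finset.range n, (k * t n + m)) / (k ! * lahGen n k 1))) atTop (nhds 0) := by
    refine squeeze_zero_norm (fun n => ?_) (tendsto_zero_iff_norm_tendsto_zero.1
      (tendsto_lahGen_div_sub k hk fun n => (ht1 n).le))
    rw [norm_mul, ← Complex.ofReal_neg, Complex.norm_exp_ofReal_mul_I, one_mul]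
  have hsum := hmain.add hrem
  rw [add_zero] at hsum
  refine hsum.congr' ?_
  have hδn : Tendsto (fun n => ‖δ n‖) atTop (nhds 0) := by simpa using hδ.norm
  filter_upwards [hδn.eventually_le_const (by norm_num : (0 : ℝ) < 1 / 2)] with n hn
  have h1 := prod_add_div_eq_exp k n hk hn
  have h2 : ∀ m : ℕ, (k : ℂ) + δ n + m = k * t n + m := fun m => by rw [hδ_def]; ring
  simp only [h2] at h1
  rw [mul_sub, h1, Function.comp_apply, Real.div_sqrt]
  have h3 : (a n : ℂ) * (t n - 1) - (θ * √(a n) : ℝ) * Complex.I +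
      (∑ m ∈ Finset.range n, Complex.log (1 + δ n / (k + m)) - δ n * Real.log n) =
      -(θ * √(a n) : ℝ) * Complex.I + ∑ m ∈ Finset.range n, Complex.log (1 + δ n / (k + m)) := by
    rw [hδ_def, ha_def]
    push_cast
    ring
  rw [h3, Complex.exp_add]
  ring

/-- Moves the limit from the index set {n ≥ k} to ℕ: n ↦ n - k tends to infinity and is inverse to
the shift. -/
theorem tendsto_atTop_subtype_of_tendsto_add {α : Type*} {k : ℕ} {F : {n : ℕ // k ≤ n} → α}
    {l : Filter α} (h : Tendsto (fun N : ℕ => F ⟨N + k, Nat.le_add_left k N⟩) atTop l) :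
    Tendsto F atTop l := by
  have hv : Tendsto (fun n : Set.Ici k => n.1 - k) atTop atTop :=
    (tendsto_sub_atTop_nat k).comp (tendsto_comp_val_Ici_atTop.2 tendsto_id)
  refine (h.comp hv).congr fun n => congrArg F (Subtype.ext ?_)
  exact Nat.sub_add_cancel n.2

/-- For fixed `k ≥ 1` and random variables `X n ~ Lah(n,k)`, `n ≥ k`, on arbitrary probability
spaces, `(X n - k log n) / √(k log n)` converges in distribution to `N(0,1)` as `n → ∞`. -/
theorem mainTheorem10 (k : ℕ) (hk : 1 ≤ k)
    {Ω : {n : ℕ // k ≤ n} → Type*} [∀ n, MeasurableSpace (Ω n)]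
    (P : (n : {n : ℕ // k ≤ n}) → Measure (Ω n)) [∀ n, IsProbabilityMeasure (P n)]
    (X : (n : {n : ℕ // k ≤ n}) → Ω n → ℕ)
    (hX : ∀ n : {n : ℕ // k ≤ n}, HasLaw (X n) (lahPMF n.1 k hk n.2).toMeasure (P n))
    {Ω' : Type*} [MeasurableSpace Ω'] (P' : Measure Ω') [IsProbabilityMeasure P']
    (Z : Ω' → ℝ) (hZ : HasLaw Z (gaussianReal 0 1) P') :
    TendstoInDistribution
      (fun (n : {n : ℕ // k ≤ n}) (ω : Ω n) =>
        ((X n ω : ℝ) - (k : ℝ) * Real.log (n.1 : ℝ)) / √((k : ℝ) * Real.log (n.1 : ℝ)))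
      atTop Z P P' := by
  refine ⟨fun n => ?_, hZ.aemeasurable, ?_⟩
  · exact (Measurable.of_discrete (f := fun j : ℕ =>
      ((j : ℝ) - k * Real.log n.1) / √(k * Real.log n.1))).comp_aemeasurable (hX n).aemeasurable
  · refine tendsto_atTop_subtype_of_tendsto_add ?_
    refine ProbabilityMeasure.tendsto_of_tendsto_charFun fun θ => ?_
    simp only [ProbabilityMeasure.coe_mk]
    rw [hZ.map_eq, charFun_gaussianReal]
    have h := (tendsto_add_atTop_iff_nat k).2 (tendsto_charFun_lah k hk θ)
    convert h using 2 with N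
    · exact charFun_map_lah hk (Nat.le_add_left k N) (hX ⟨N + k, Nat.le_add_left k N⟩) _ _ θ
    · congr 1
      simp [neg_div]
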